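/- **Burnside's $p^a q^b$ theorem.** Let $G$ be a finite group with $|G| = p^a q^b$, where $p$ and $q$ are prime numbers and $a, b \ge 0$ are integers. Then $G$ is solvable, i.e. its derived series reaches the trivial subgroup after finitely many steps. -/

import Mathlib

/-! Induction on `|G|`, through a normal subgroup and its quotient, leaves `G` simple. A nontrivial
central element `g` of a Sylow subgroup for one prime has a class of size a power of the other, say
`q ^ k`. For an irreducible character `χ` of degree `d` prime to `q`, `χ(g) / d` is an algebraic
integer, so `χ(g) = 0` or `g` acts by a scalar (`exists_map_single_eq_scalar`). Since `∑ d χ(g) =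
0`, some nontrivial `χ` has `q ∤ d` and `χ(g) ≠ 0` (`exists_nontrivial_matrixFactor`). By simplicity
it is faithful, so `g` is central and `G` abelian. The irreducibles are the matrix factors of
`ℂ[G]`. -/

/-! ### Matrices of finite order. -/

open Polynomial in
theorem Matrix.eq_scalar_of_pow_eq_one {d N : ℕ} (hN : N ≠ 0) (M : Matrix (Fin d) (Fin d) ℂ)
    (hM : M ^ N = 1) {c : ℂ} (hcN : c ^ N = 1) (hc : ∀ r ∈ M.charpoly.roots, r = c) :
    M = Matrix.scalar (Fin d) c := by
  have hsplit := IsAlgClosed.splits M.charpoly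
  have hroots : M.charpoly.roots = Multiset.replicate d c := by
    rw [Multiset.eq_replicate]
    refine ⟨?_, hc⟩
    rw [← hsplit.natDegree_eq_card_roots, M.charpoly_natDegree_eq_dim, Fintype.card_fin]
  have hchar : M.charpoly = (X - C c) ^ d := by
    rw [hsplit.eq_prod_roots_of_monic M.charpoly_monic, hroots]
    simp
  obtain ⟨Q, hQ⟩ : X - C c ∣ (X ^ N - 1 : ℂ[X]) := by
    rw [dvd_iff_isRoot]; simp [hcN]
  have hsep : (X ^ N - 1 : ℂ[X]).Separable := by
    have := separable_X_pow_sub_C (1 : ℂ) (n := N) (by exact_mod_cast hN) one_ne_zero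
    simpa using this
  rw [hQ] at hsep
  -- Multiplied by `X - C c`, this Bézout identity has both terms killed at `M`: one by
  -- Cayley–Hamilton, one by `M ^ N = 1`.
  obtain ⟨u, v, huv⟩ := hsep.isCoprime.pow_left (m := d)
  have h1 : aeval M (X - C c) * aeval M Q = 0 := by
    rw [← map_mul, ← hQ]; simp [hM]
  have h2 : aeval M ((X - C c) ^ d) = 0 := by rw [← hchar, M.aeval_self_charpoly]
  have h3 : aeval M (X - C c) = 0 := by
    have h := congrArg (fun f => aeval M ((X - C c) * f)) huv
    simp only [mul_one] at h
    rw [← h, mul_add, map_add, ← mul_assoc, map_mul, h2, mul_zero, zero_add,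
      mul_left_comm, map_mul, map_mul, h1, mul_zero]
  have h4 : M - algebraMap ℂ _ c = 0 := by simpa using h3
  rw [sub_eq_zero.1 h4]
  rfl

/-- All conjugates of the mean have modulus at most 1, so by Kronecker it is a root of unity. By
strict convexity, a mean of unit vectors has norm 1 only if they coincide. -/
theorem eq_of_isIntegral_sum_div_card {ι : Type*} [Fintype ι] {N : ℕ} (hN : N ≠ 0) (f : ι → ℂ)
    (hf : ∀ i, f i ^ N = 1) (hint : IsIntegral ℤ ((∑ i, f i) / Fintype.card ι))
    (h0 : ∑ i, f i ≠ 0) (i j : ι) : f i = f j := by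
  classical
  have hιpos : (0 : ℝ) < Fintype.card ι := by
    have : Nonempty ι := ⟨i⟩
    exact_mod_cast Fintype.card_pos
  have hnorm : ∀ {z : ℂ}, z ^ N = 1 → ‖z‖ = 1 := fun hz => Complex.norm_eq_one_of_pow_eq_one hz hN
  let K := IntermediateField.adjoin ℚ (Set.range f)
  have hfd : FiniteDimensional ℚ K := by
    refine IntermediateField.finiteDimensional_adjoin ?_
    rintro _ ⟨i, rfl⟩
    exact IsIntegral.of_pow (Nat.pos_of_ne_zero hN) (by rw [hf i]; exact isIntegral_one)
  have hnf : NumberField K := { to_charZero := inferInstance, to_finiteDimensional := hfd }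
  let g : ι → K := fun i => ⟨f i, IntermediateField.subset_adjoin _ _ ⟨i, rfl⟩⟩
  let x : K := (∑ i, g i) / Fintype.card ι
  have hx : algebraMap K ℂ x = (∑ i, f i) / Fintype.card ι := by
    simp only [x, map_div₀, map_sum, map_natCast]
    rfl
  have hx0 : x ≠ 0 := by
    intro h
    rw [h, map_zero, eq_comm, div_eq_zero_iff] at hx
    rcases hx with h | h
    · exact h0 h
    · exact hιpos.ne' (by exact_mod_cast h)
  have hxi : IsIntegral ℤ x := by
    rw [← hx] at hint
    exact (isIntegral_algebraMap_iff (algebraMap K ℂ).injective).1 hint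
  have hemb : ∀ φ : K →+* ℂ, ‖φ x‖ ≤ 1 := by
    intro φ
    simp only [x, map_div₀, map_sum, map_natCast, norm_div, Complex.norm_natCast]
    rw [div_le_one hιpos]
    refine (norm_sum_le _ _).trans ?_
    have : ∀ i, ‖φ (g i)‖ = 1 := fun i => hnorm (by
      rw [← map_pow, ← map_one φ]
      congr 1
      exact Subtype.ext (hf i))
    simp [this]
  obtain ⟨n, hn, hxn⟩ := NumberField.Embeddings.pow_eq_one_of_norm_le_one K ℂ hx0 hxi hemb
  have hmod : ‖(∑ i, f i) / Fintype.card ι‖ = 1 := by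
    rw [← hx]
    exact Complex.norm_eq_one_of_pow_eq_one (by rw [← map_pow, hxn, map_one]) hn.ne'
  by_contra hij
  have := norm_sum_lt_of_strictConvexSpace (t := Finset.univ) (r := 1) (z := f)
    (w := fun _ => (Fintype.card ι : ℝ)⁻¹) (fun _ _ => by positivity)
    (by simp [hιpos.ne']) (Finset.mem_univ i) (Finset.mem_univ j) hij
    (by positivity) (by positivity) (fun i _ => (hnorm (hf i)).le)
  rw [← Finset.smul_sum] at this
  refine this.ne ?_
  rw [← hmod]
  congr 1
  rw [Complex.real_smul, div_eq_inv_mul]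
  push_cast
  rfl

theorem Matrix.pow_eq_one_of_mem_roots_charpoly {d N : ℕ} {M : Matrix (Fin d) (Fin d) ℂ}
    (hM : M ^ N = 1) {r : ℂ} (hr : r ∈ M.charpoly.roots) : r ^ N = 1 := by
  have hr' := (Polynomial.mem_roots'.1 hr).2
  rw [← Matrix.mem_spectrum_iff_isRoot_charpoly] at hr'
  have := spectrum.pow_mem_pow M N hr'
  rw [hM] at this
  rcases isEmpty_or_nonempty (Fin d) with h | h
  · have := M.charpoly_natDegree_eq_dim
    have h1 := (IsAlgClosed.splits M.charpoly).natDegree_eq_card_roots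
    rw [this, Fintype.card_eq_zero, eq_comm, Multiset.card_eq_zero] at h1
    simp at hr
  · rwa [spectrum.one_eq, Set.mem_singleton_iff] at this

/-- A matrix of finite order whose normalized trace is a nonzero algebraic integer is scalar. -/
theorem Matrix.exists_eq_scalar_of_isIntegral_trace_div {d N : ℕ} (hN : N ≠ 0)
    {M : Matrix (Fin d) (Fin d) ℂ} (hM : M ^ N = 1) (hint : IsIntegral ℤ (M.trace / d))
    (h0 : M.trace ≠ 0) : ∃ c, M = Matrix.scalar (Fin d) c := by
  classical
  have hcard : M.charpoly.roots.card = d := by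
    rw [← (IsAlgClosed.splits M.charpoly).natDegree_eq_card_roots, M.charpoly_natDegree_eq_dim,
      Fintype.card_fin]
  let f : M.charpoly.roots → ℂ := fun r => r.1
  have hsum : ∑ i, f i = M.trace := by
    rw [Matrix.trace_eq_sum_roots_charpoly, Finset.sum, Multiset.map_univ_coe]
  have hcard' : Fintype.card M.charpoly.roots = d := by rw [Multiset.card_coe, hcard]
  have hf : ∀ i, f i ^ N = 1 := fun i =>
    Matrix.pow_eq_one_of_mem_roots_charpoly hM (Multiset.coe_mem)
  have key := eq_of_isIntegral_sum_div_card hN f hf (by rwa [hsum, hcard']) (by rwa [hsum])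
  have hne : M.charpoly.roots ≠ 0 := by
    intro h
    rw [Matrix.trace_eq_sum_roots_charpoly, h] at h0
    simp at h0
  obtain ⟨c, hc⟩ := Multiset.exists_mem_of_ne_zero hne
  refine ⟨c, Matrix.eq_scalar_of_pow_eq_one hN M hM
    (Matrix.pow_eq_one_of_mem_roots_charpoly hM hc) fun r hr => ?_⟩
  have h (s) (hs : s ∈ M.charpoly.roots) : ∃ i, f i = s :=
    ⟨⟨s, ⟨0, Multiset.count_pos.2 hs⟩⟩, rfl⟩
  obtain ⟨i, rfl⟩ := h r hr
  obtain ⟨j, rfl⟩ := h c hc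
  exact key i j

theorem Matrix.mem_range_scalar_of_forall_commute {d : ℕ} {M : Matrix (Fin d) (Fin d) ℂ}
    (h : ∀ B, Commute B M) : ∃ c, M = Matrix.scalar (Fin d) c := by
  obtain ⟨c, hc⟩ := Matrix.mem_range_scalar_of_commute_single (M := M) fun i j _ => h _
  exact ⟨c, hc.symm⟩

/-! ### The regular representation. -/

section Pi
variable {n : ℕ} {d : Fin n → ℕ}

theorem LinearMap.trace_mulLeft_pi_matrix (x : Π i, Matrix (Fin (d i)) (Fin (d i)) ℂ) :
    LinearMap.trace ℂ _ (LinearMap.mulLeft ℂ x) = ∑ i, (d i : ℂ) * (x i).trace := by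
  classical
  rw [LinearMap.trace_eq_matrix_trace ℂ
    (Pi.basis fun i => Matrix.stdBasis ℂ (Fin (d i)) (Fin (d i)))]
  simp only [Matrix.trace, Matrix.diag, LinearMap.toMatrix_apply]
  rw [Fintype.sum_sigma]
  refine Finset.sum_congr rfl fun i _ => ?_
  have h (a b : Fin (d i)) : (x i * (Matrix.of (Pi.single a (Pi.single b 1)) :
      Matrix (Fin (d i)) (Fin (d i)) ℂ)) a b = x i a a := by
    rw [Matrix.mul_apply, Finset.sum_eq_single a] <;> simp +contextual
  rw [Fintype.sum_prod_type, Finset.sum_comm]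
  simp [Pi.basis_repr, Matrix.stdBasis, h]

end Pi

section GroupAlgebra
variable {G : Type*} [Group G] [Fintype G]

theorem MonoidAlgebra.trace_mulLeft_single {g : G} (hg : g ≠ 1) :
    LinearMap.trace ℂ _ (LinearMap.mulLeft ℂ (MonoidAlgebra.single g (1 : ℂ))) = 0 := by
  classical
  rw [LinearMap.trace_eq_matrix_trace ℂ (MonoidAlgebra.basis G ℂ)]
  simp only [Matrix.trace, Matrix.diag, LinearMap.toMatrix_apply]
  refine Finset.sum_eq_zero fun h _ => ?_
  simp [MonoidAlgebra.basis, hg]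

theorem sum_mul_trace_eq_zero {n : ℕ} {d : Fin n → ℕ}
    (φ : MonoidAlgebra ℂ G ≃ₐ[ℂ] Π i, Matrix (Fin (d i)) (Fin (d i)) ℂ) {g : G} (hg : g ≠ 1) :
    ∑ i, (d i : ℂ) * (φ (MonoidAlgebra.single g 1) i).trace = 0 := by
  rw [← LinearMap.trace_mulLeft_pi_matrix, ← MonoidAlgebra.trace_mulLeft_single hg,
    ← LinearMap.trace_conj' _ φ.toLinearEquiv]
  congr 1
  refine LinearMap.ext fun x => ?_
  simp [LinearEquiv.conj_apply]

theorem MonoidAlgebra.isIntegral_sum_single (s : Finset G) :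
    IsIntegral ℤ (∑ x ∈ s, MonoidAlgebra.single x (1 : ℂ)) := by
  have : Module.Finite ℤ (MonoidAlgebra ℤ G) := Module.Finite.of_basis (MonoidAlgebra.basis G ℤ)
  have h := (Algebra.IsIntegral.isIntegral (R := ℤ)
    (∑ x ∈ s, MonoidAlgebra.single x (1 : ℤ) : MonoidAlgebra ℤ G)).map
      (MonoidAlgebra.mapRingHom G (Int.castRingHom ℂ)).toIntAlgHom
  simpa using h

/-! ### Integrality for one irreducible representation. -/

section Rep
variable {d : ℕ} (π : MonoidAlgebra ℂ G →ₐ[ℂ] Matrix (Fin d) (Fin d) ℂ)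

theorem map_single_pow_card (g : G) : π (MonoidAlgebra.single g 1) ^ Fintype.card G = 1 := by
  rw [← map_pow, MonoidAlgebra.single_pow]
  simp [← MonoidAlgebra.one_def]

theorem isIntegral_trace_map_single (g : G) : IsIntegral ℤ (π (MonoidAlgebra.single g 1)).trace := by
  rw [Matrix.trace_eq_sum_roots_charpoly]
  refine IsIntegral.multiset_sum fun r hr => ?_
  refine IsIntegral.of_pow Fintype.card_pos (n := Fintype.card G) ?_
  rw [Matrix.pow_eq_one_of_mem_roots_charpoly (map_single_pow_card π g) hr]
  exact isIntegral_one

-- The class sum is central, hence acts by a scalar `ω`, integral because the class sum is integral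
-- over `ℤ`. Taking traces computes `ω`.
open Classical in
theorem isIntegral_card_mul_trace_div [NeZero d] (hπ : Function.Surjective π) (g : G) :
    IsIntegral ℤ ((Finset.univ.filter (IsConj g)).card *
      (π (MonoidAlgebra.single g 1)).trace / d) := by
  set s := Finset.univ.filter (IsConj g)
  set z : MonoidAlgebra ℂ G := ∑ x ∈ s, MonoidAlgebra.single x (1 : ℂ) with hz
  have hcomm (h : G) : Commute (MonoidAlgebra.single h (1 : ℂ)) z := by
    simp only [Commute, SemiconjBy, hz, Finset.mul_sum, Finset.sum_mul, MonoidAlgebra.single_mul_single,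
      mul_one]
    refine Finset.sum_bij' (fun x _ => h * x * h⁻¹) (fun x _ => h⁻¹ * x * h) ?_ ?_ ?_ ?_ ?_
    · intro x hx
      simp only [s, Finset.mem_filter, Finset.mem_univ, true_and] at hx ⊢
      exact hx.trans (isConj_iff.2 ⟨h, rfl⟩)
    · intro x hx
      simp only [s, Finset.mem_filter, Finset.mem_univ, true_and] at hx ⊢
      exact hx.trans (isConj_iff.2 ⟨h⁻¹, by simp⟩)
    · intro x _; group
    · intro x _; group
    · intro x _; simp
  have hcomm' (a : MonoidAlgebra ℂ G) : Commute a z := by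
    induction a using MonoidAlgebra.induction_linear with
    | zero => exact Commute.zero_left _
    | add f g hf hg => exact hf.add_left hg
    | single a b =>
      have := (hcomm a).smul_left b
      rwa [MonoidAlgebra.smul_single, smul_eq_mul, mul_one] at this
  obtain ⟨ω, hω⟩ := Matrix.mem_range_scalar_of_forall_commute (M := π z) fun B => by
    obtain ⟨a, rfl⟩ := hπ B
    exact (hcomm' a).map π
  have hint : IsIntegral ℤ ω := by
    have h := (MonoidAlgebra.isIntegral_sum_single s).map (π.restrictScalars ℤ)
    rw [← hz, AlgHom.restrictScalars_apply, hω] at h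
    exact (isIntegral_algebraMap_iff
      (FaithfulSMul.algebraMap_injective ℂ (Matrix (Fin d) (Fin d) ℂ))).1 h
  have htr : (π z).trace = s.card * (π (MonoidAlgebra.single g 1)).trace := by
    rw [hz, map_sum, Matrix.trace_sum, Finset.sum_congr rfl (g := fun _ =>
      (π (MonoidAlgebra.single g 1)).trace), Finset.sum_const, nsmul_eq_mul]
    intro x hx
    simp only [s, Finset.mem_filter, Finset.mem_univ, true_and] at hx
    obtain ⟨c, rfl⟩ := isConj_iff.1 hx
    rw [← mul_one (1 : ℂ), ← MonoidAlgebra.single_mul_single, map_mul, Matrix.trace_mul_comm,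
      ← map_mul, MonoidAlgebra.single_mul_single]
    simp [← mul_assoc]
  rw [← htr, hω]
  simpa [NeZero.ne d] using hint

open Classical in
/-- If the degree of an irreducible representation is coprime to the size of the conjugacy class
of `g`, then `g` acts by a scalar unless its character vanishes at `g`. -/
theorem exists_map_single_eq_scalar [NeZero d] (hπ : Function.Surjective π) (g : G)
    (hco : (Finset.univ.filter (IsConj g)).card.Coprime d)
    (h0 : (π (MonoidAlgebra.single g 1)).trace ≠ 0) :
    ∃ c, π (MonoidAlgebra.single g 1) = Matrix.scalar (Fin d) c := by
  refine Matrix.exists_eq_scalar_of_isIntegral_trace_div Fintype.card_ne_zero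
    (map_single_pow_card π g) ?_ h0
  obtain ⟨u, v, huv⟩ := Nat.isCoprime_iff_coprime.2 hco
  have huv' := congrArg (Int.cast : ℤ → ℂ) huv
  push_cast at huv'
  have hd : (d : ℂ) ≠ 0 := by exact_mod_cast NeZero.ne d
  have hcast (m : ℤ) : IsIntegral ℤ (m : ℂ) := isIntegral_algebraMap
  rw [show (π (MonoidAlgebra.single g 1)).trace / d =
      u * ((Finset.univ.filter (IsConj g)).card * (π (MonoidAlgebra.single g 1)).trace / d) +
        v * (π (MonoidAlgebra.single g 1)).trace by
    field_simp
    rw [mul_comm (d : ℂ), huv']]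
  exact ((hcast u).mul (isIntegral_card_mul_trace_div π hπ g)).add
    ((hcast v).mul (isIntegral_trace_map_single π g))

end Rep

/-! ### Matrix factors of the group algebra. -/

section Decomposition
variable {n : ℕ} {d : Fin n → ℕ}
  (φ : MonoidAlgebra ℂ G ≃ₐ[ℂ] Π i, Matrix (Fin (d i)) (Fin (d i)) ℂ)

/-- The projection of the group algebra onto one of its matrix factors. -/
noncomputable def matrixFactor (i : Fin n) : MonoidAlgebra ℂ G →ₐ[ℂ] Matrix (Fin (d i)) (Fin (d i)) ℂ :=
  (Pi.evalAlgHom ℂ _ i).comp φ.toAlgHom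

omit [Fintype G] in
theorem matrixFactor_surjective (i : Fin n) : Function.Surjective (matrixFactor φ i) := by
  classical
  exact (Function.surjective_eval i).comp φ.surjective

/-- The sum of all group elements is central and absorbs each `h`. Where it acts by a nonzero
scalar, every `h` acts as 1. -/
theorem exists_matrixFactor_single_eq_one : ∃ i, 0 < d i ∧
    ∀ h, matrixFactor φ i (MonoidAlgebra.single h 1) = 1 := by
  set s : MonoidAlgebra ℂ G := ∑ x, MonoidAlgebra.single x (1 : ℂ) with hs
  have hmul (h : G) : MonoidAlgebra.single h (1 : ℂ) * s = s := by
    simp only [hs, Finset.mul_sum, MonoidAlgebra.single_mul_single, mul_one]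
    exact Fintype.sum_equiv (Equiv.mulLeft h) _ _ fun _ => rfl
  have hmul' (h : G) : s * MonoidAlgebra.single h (1 : ℂ) = s := by
    simp only [hs, Finset.sum_mul, MonoidAlgebra.single_mul_single, mul_one]
    exact Fintype.sum_equiv (Equiv.mulRight h) _ _ fun _ => rfl
  have hcomm (a : MonoidAlgebra ℂ G) : Commute a s := by
    induction a using MonoidAlgebra.induction_linear with
    | zero => exact Commute.zero_left _
    | add f g hf hg => exact hf.add_left hg
    | single a b =>
      have : Commute (MonoidAlgebra.single a (1 : ℂ)) s := (hmul a).trans (hmul' a).symm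
      simpa using this.smul_left b
  have hs0 : φ s ≠ 0 := by
    rw [Ne, map_eq_zero_iff φ φ.injective]
    intro h
    have h1 := congrArg (fun f : MonoidAlgebra ℂ G =>
      MonoidAlgebra.lift ℂ ℂ G (1 : G →* ℂ) f) h
    simp [hs] at h1
  obtain ⟨i, hi⟩ := Function.ne_iff.1 hs0
  obtain ⟨c, hc⟩ := Matrix.mem_range_scalar_of_forall_commute (M := matrixFactor φ i s) fun B => by
    obtain ⟨a, rfl⟩ := matrixFactor_surjective φ i B
    exact (hcomm a).map _
  have hi' : matrixFactor φ i s ≠ 0 := hi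
  have hc0 : c ≠ 0 := by
    rintro rfl
    exact hi' (by rw [hc, map_zero])
  refine ⟨i, Nat.pos_of_ne_zero fun h => ?_, fun h => ?_⟩
  · have : IsEmpty (Fin (d i)) := by rw [h]; infer_instance
    exact hi' (Subsingleton.elim _ _)
  · have h1 := congrArg (matrixFactor φ i) (hmul h)
    rw [map_mul, hc] at h1
    have h2 : c • matrixFactor φ i (MonoidAlgebra.single h 1) = c • 1 := by
      rwa [Matrix.scalar_apply, ← Matrix.smul_one_eq_diagonal, mul_smul_comm, mul_one] at h1
    exact smul_right_injective _ hc0 h2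

omit [Fintype G] in
theorem matrixFactor_eq_smul_one {i : Fin n}
    (hi : ∀ h, matrixFactor φ i (MonoidAlgebra.single h 1) = 1) (a : MonoidAlgebra ℂ G) :
    matrixFactor φ i a = MonoidAlgebra.lift ℂ ℂ G (1 : G →* ℂ) a • 1 := by
  have : matrixFactor φ i = (Algebra.ofId ℂ _).comp (MonoidAlgebra.lift ℂ ℂ G (1 : G →* ℂ)) :=
    MonoidAlgebra.algHom_ext (fun h => by simp [hi]) (Subsingleton.elim _ _)
  rw [this]
  simp [Algebra.ofId_apply, Algebra.algebraMap_eq_smul_one]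

omit [Fintype G] in
theorem matrixFactor_trivial_unique [∀ i, NeZero (d i)] {i j : Fin n}
    (hi : ∀ h, matrixFactor φ i (MonoidAlgebra.single h 1) = 1)
    (hj : ∀ h, matrixFactor φ j (MonoidAlgebra.single h 1) = 1) : i = j := by
  classical
  by_contra hij
  obtain ⟨a, ha⟩ := φ.surjective (Pi.single i 1)
  have h1 : matrixFactor φ i a = 1 := by
    change φ a i = 1
    rw [ha, Pi.single_eq_same]
  have h2 : matrixFactor φ j a = 0 := by
    change φ a j = 0
    rw [ha, Pi.single_eq_of_ne (Ne.symm hij)]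
  rw [matrixFactor_eq_smul_one φ hi] at h1
  rw [matrixFactor_eq_smul_one φ hj, smul_eq_zero_iff_left one_ne_zero] at h2
  rw [h2, zero_smul] at h1
  exact zero_ne_one h1

omit [Fintype G] in
theorem degree_eq_one_of_matrixFactor_trivial {i : Fin n} (hd : 0 < d i)
    (hi : ∀ h, matrixFactor φ i (MonoidAlgebra.single h 1) = 1) : d i = 1 := by
  by_contra hne
  obtain ⟨a, ha⟩ := matrixFactor_surjective φ i
    (Matrix.single ⟨0, hd⟩ ⟨1, by omega⟩ 1)
  rw [matrixFactor_eq_smul_one φ hi] at ha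
  have := congrFun (congrFun ha ⟨0, hd⟩) ⟨1, by omega⟩
  simp at this

theorem exists_nontrivial_matrixFactor [∀ i, NeZero (d i)] {p : ℕ} (hp : p.Prime) {g : G}
    (hg : g ≠ 1) : ∃ i, (∃ h, matrixFactor φ i (MonoidAlgebra.single h 1) ≠ 1) ∧ ¬ p ∣ d i ∧
      (matrixFactor φ i (MonoidAlgebra.single g 1)).trace ≠ 0 := by
  classical
  by_contra! hcon
  obtain ⟨i₀, hd, hi₀⟩ := exists_matrixFactor_single_eq_one φ
  have hd1 := degree_eq_one_of_matrixFactor_trivial φ hd hi₀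
  have hsum := sum_mul_trace_eq_zero φ hg
  change ∑ i, (d i : ℂ) * (matrixFactor φ i (MonoidAlgebra.single g 1)).trace = 0 at hsum
  rw [← Finset.add_sum_erase _ _ (Finset.mem_univ i₀), hi₀, Matrix.trace_one, Fintype.card_fin,
    hd1, Nat.cast_one, mul_one] at hsum
  have hp0 : (p : ℂ) ≠ 0 := by exact_mod_cast hp.ne_zero
  have key : IsIntegral ℤ (∑ i ∈ Finset.univ.erase i₀,
      (d i : ℂ) * (matrixFactor φ i (MonoidAlgebra.single g 1)).trace / p) := by
    refine IsIntegral.sum _ fun i hi => ?_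
    by_cases hdvd : p ∣ d i
    · obtain ⟨k, hk⟩ := hdvd
      have hk' : (d i : ℂ) = p * k := by rw [hk, Nat.cast_mul]
      rw [hk', mul_assoc, mul_div_cancel_left₀ _ hp0]
      have hk_int : IsIntegral ℤ (k : ℂ) := by
        simpa using isIntegral_algebraMap (R := ℤ) (A := ℂ) (x := (k : ℤ))
      exact hk_int.mul (isIntegral_trace_map_single _ g)
    · have hne : ∃ h, matrixFactor φ i (MonoidAlgebra.single h 1) ≠ 1 := by
        by_contra! h
        exact Finset.ne_of_mem_erase hi (matrixFactor_trivial_unique φ h hi₀)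
      rw [hcon i hne hdvd, mul_zero, zero_div]
      exact isIntegral_zero
  -- The trivial factor contributes 1, so the other terms sum to `-1`.
  rw [← Finset.sum_div, eq_neg_of_add_eq_zero_right hsum] at key
  have hq : IsIntegral ℤ (-1 / p : ℚ) := by
    refine (isIntegral_algebraMap_iff (algebraMap ℚ ℂ).injective).1 ?_
    simpa using key
  obtain ⟨m, hm⟩ := IsIntegrallyClosed.isIntegral_iff.1 hq
  have hp0' : (p : ℚ) ≠ 0 := by exact_mod_cast hp.ne_zero
  rw [eq_div_iff hp0', algebraMap_int_eq, eq_intCast] at hm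
  have hm' : m * p = -1 := by exact_mod_cast hm
  have : (p : ℤ) ∣ 1 := ⟨-m, by linarith⟩
  exact hp.one_lt.ne' (by exact_mod_cast Int.eq_one_of_dvd_one (by positivity) this)

end Decomposition

/-! ### Simple groups, then the induction. -/

open Classical in
/-- A finite simple group with a nontrivial element whose conjugacy class has prime power size
is commutative. -/
theorem IsSimpleGroup.center_eq_top_of_card_conj [IsSimpleGroup G] {p k : ℕ} (hp : p.Prime) {g : G}
    (hg : g ≠ 1) (hcard : (Finset.univ.filter (IsConj g)).card = p ^ k) :
    Subgroup.center G = ⊤ := by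
  have : NeZero (Nat.card G : ℂ) := ⟨by exact_mod_cast Nat.card_pos.ne'⟩
  have : Module.Finite ℂ (MonoidAlgebra ℂ G) := Module.Finite.of_basis (MonoidAlgebra.basis G ℂ)
  obtain ⟨n, d, _, ⟨φ⟩⟩ :=
    IsSemisimpleRing.exists_algEquiv_pi_matrix_of_isAlgClosed ℂ (MonoidAlgebra ℂ G)
  obtain ⟨i, ⟨h, hh⟩, hdvd, htr⟩ := exists_nontrivial_matrixFactor φ hp hg
  obtain ⟨c, hc⟩ := exists_map_single_eq_scalar _ (matrixFactor_surjective φ i) g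
    (by rw [hcard]; exact ((hp.coprime_iff_not_dvd).2 hdvd).pow_left k) htr
  let ρ : G →* Matrix (Fin (d i)) (Fin (d i)) ℂ :=
    (matrixFactor φ i).toRingHom.toMonoidHom.comp (MonoidAlgebra.of ℂ G)
  have hker : ρ.toHomUnits.ker = ⊥ := by
    refine (MonoidHom.normal_ker _).eq_bot_or_eq_top.resolve_right fun htop => hh ?_
    have : h ∈ ρ.toHomUnits.ker := htop ▸ Subgroup.mem_top h
    exact congrArg Units.val (MonoidHom.mem_ker.1 this)
  have hmem : g ∈ Subgroup.center G := by
    rw [Subgroup.mem_center_iff]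
    intro x
    apply (MonoidHom.ker_eq_bot_iff _).1 hker
    ext1
    rw [MonoidHom.coe_toHomUnits, MonoidHom.coe_toHomUnits, map_mul, map_mul,
      show ρ g = Matrix.scalar _ c from hc]
    exact ((Matrix.scalar_commute c (fun _ => Commute.all _ _) _).eq).symm
  refine (Subgroup.normal_of_characteristic _).eq_bot_or_eq_top.resolve_left fun hbot => hg ?_
  rw [hbot] at hmem
  exact Subgroup.mem_bot.1 hmem

end GroupAlgebra

open Classical in
theorem card_filter_isConj {G : Type*} [Group G] [Fintype G] (g : G) :
    (Finset.univ.filter (IsConj g)).card = (Subgroup.centralizer {g}).index := by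
  have h1 := MulAction.index_stabilizer (ConjAct G) g
  rw [ConjAct.orbit_eq_carrier_conjClasses] at h1
  have h2 : (Subgroup.centralizer {g}).index = (MulAction.stabilizer (ConjAct G) g).index := by
    have hsurj : Function.Surjective (ConjAct.toConjAct (G := G)).toMonoidHom :=
      ConjAct.toConjAct.surjective
    refine Eq.trans ?_ (Subgroup.index_comap_of_surjective _ hsurj)
    exact congrArg Subgroup.index (Subgroup.centralizer_eq_comap_stabilizer g)
  rw [h2, h1, ← Set.ncard_coe_finset]
  congr 1
  ext x
  rw [Finset.mem_coe, Finset.mem_filter, ConjClasses.mem_carrier_iff_mk_eq,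
    ConjClasses.mk_eq_mk_iff_isConj, isConj_comm]
  simp only [Finset.mem_univ, true_and]

/-- A finite simple group whose order has at most two prime factors is commutative. -/
theorem IsSimpleGroup.isSolvable_of_card_eq {G : Type*} [Group G] [IsSimpleGroup G] {p q a b : ℕ}
    (hp : p.Prime) (hq : q.Prime) (hG : Nat.card G = p ^ a * q ^ b) (hdvd : p ∣ Nat.card G) :
    Group.IsSolvable G := by
  classical
  have : Fact p.Prime := ⟨hp⟩
  have : Finite G := Nat.finite_of_card_ne_zero (by
    rw [hG]; exact mul_ne_zero (pow_ne_zero _ hp.ne_zero) (pow_ne_zero _ hq.ne_zero))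
  have : Fintype G := Fintype.ofFinite G
  let P : Sylow p G := default
  have hP : Nontrivial P := by
    rw [← Finite.one_lt_card_iff_nontrivial]
    exact hp.one_lt.trans_le (Nat.le_of_dvd Nat.card_pos (P.dvd_card_of_dvd_card hdvd))
  have := P.isPGroup'.center_nontrivial
  obtain ⟨z, hz⟩ := exists_ne (1 : Subgroup.center P)
  have hg : (z : G) ≠ 1 := by simpa using hz
  have hle : (P : Subgroup G) ≤ Subgroup.centralizer {(z : G)} := by
    intro x hx
    rw [Subgroup.mem_centralizer_singleton_iff]
    exact congrArg Subtype.val (Subgroup.mem_center_iff.1 z.2 ⟨x, hx⟩)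
  have hidx : (Subgroup.centralizer {(z : G)}).index ∣ q ^ b := by
    have h1 := Subgroup.index_dvd_of_le hle
    have h2 : (P : Subgroup G).index ∣ p ^ a * q ^ b := hG ▸ (P : Subgroup G).index_dvd_card
    have h3 : (P : Subgroup G).index.Coprime (p ^ a) :=
      ((hp.coprime_iff_not_dvd.2 P.not_dvd_index).symm).pow_right a
    exact h1.trans (h3.dvd_of_dvd_mul_left h2)
  obtain ⟨k, -, hk⟩ := (Nat.dvd_prime_pow hq).1 hidx
  have htop := IsSimpleGroup.center_eq_top_of_card_conj hq hg ((card_filter_isConj _).trans hk)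
  refine Group.isSolvable_of_comm fun x y => ?_
  exact (Subgroup.mem_center_iff.1 (htop ▸ Subgroup.mem_top x : x ∈ Subgroup.center G) y).symm

theorem Nat.exists_eq_pow_mul_pow_of_dvd {p q a b m : ℕ} (hp : p.Prime) (hq : q.Prime)
    (h : m ∣ p ^ a * q ^ b) : ∃ c d, m = p ^ c * q ^ d := by
  obtain ⟨x, y, hx, hy, rfl⟩ := exists_dvd_and_dvd_of_dvd_mul h
  obtain ⟨c, -, rfl⟩ := (Nat.dvd_prime_pow hp).1 hx
  obtain ⟨d, -, rfl⟩ := (Nat.dvd_prime_pow hq).1 hy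
  exact ⟨c, d, rfl⟩

theorem mainTheorem1 {G : Type*} [Group G] (p q a b : ℕ) (hp : p.Prime) (hq : q.Prime)
    (hG : Nat.card G = p ^ a * q ^ b) : Group.IsSolvable G := by
  induction hn : Nat.card G using Nat.strong_induction_on generalizing G a b with
  | _ n ih =>
  subst hn
  have hfin : Finite G := Nat.finite_of_card_ne_zero (by
    rw [hG]; exact mul_ne_zero (pow_ne_zero _ hp.ne_zero) (pow_ne_zero _ hq.ne_zero))
  rcases subsingleton_or_nontrivial G with _ | _
  · infer_instance
  by_cases hsimple : IsSimpleGroup G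
  -- `a` or `b` may be 0, so the Sylow prime must be one that divides `|G|`.
  · obtain ⟨r, hr, hrG⟩ := Nat.exists_prime_and_dvd (Finite.one_lt_card (α := G)).ne'
    rcases hr.dvd_mul.1 (hG ▸ hrG) with h | h
    · obtain rfl := (Nat.prime_dvd_prime_iff_eq hr hp).1 (hr.dvd_of_dvd_pow h)
      exact IsSimpleGroup.isSolvable_of_card_eq hp hq hG hrG
    · obtain rfl := (Nat.prime_dvd_prime_iff_eq hr hq).1 (hr.dvd_of_dvd_pow h)
      exact IsSimpleGroup.isSolvable_of_card_eq hq hp (hG.trans (mul_comm _ _)) hrG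
  · obtain ⟨N, hN, hbot, htop⟩ : ∃ N : Subgroup G, N.Normal ∧ N ≠ ⊥ ∧ N ≠ ⊤ := by
      by_contra! h
      exact hsimple ⟨fun N hN => or_iff_not_imp_left.2 (h N hN)⟩
    have hmul := N.card_mul_index
    have hN1 : 1 < Nat.card N := (Subgroup.one_lt_card_iff_ne_bot N).2 hbot
    have hN2 : 1 < N.index := N.one_lt_index_of_ne_top htop
    rw [Group.isSolvable_iff_subgroup_quotient N]
    constructor
    · obtain ⟨c, d, h⟩ := Nat.exists_eq_pow_mul_pow_of_dvd hp hq (hG ▸ N.card_subgroup_dvd_card)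
      exact ih _ (by nlinarith) c d h rfl
    · obtain ⟨c, d, h⟩ := Nat.exists_eq_pow_mul_pow_of_dvd hp hq (hG ▸ N.index_dvd_card)
      exact ih (Nat.card (G ⧸ N)) (by rw [← Subgroup.index]; nlinarith) c d h rfl
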